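/- **Conventions.** Let $v\in\mathbb R^3$ with $|v|=1$, $\phi(x)=\langle x,v\rangle$, $dA_\phi=e^{\phi}dA$, $dV_\phi=e^{\phi}dV$. An oriented surface with Gauss map $N$ is a *translating $\lambda$-soliton* ($\lambda\in\mathbb R$) if its mean curvature (the trace of the shape operator $-dN$, that is, the sum of the principal curvatures) satisfies $H=\langle N,v\rangle+\lambda$. Let $U$ be a domain (open, connected and non-empty) of the plane $v^{\perp}$, let $u$ be a function that is smooth up to the boundary of $U$ (that is, smooth at each point of $\overline U$ as a function on $v^\perp$), and assume that the graph $$\Sigma=\{x+u(x)v:\ x\in\overline U\}$$ is compact. Put $\Gamma=\{x+u(x)v:\ x\in\partial U\}$, the boundary of $\Sigma$, and let $N$ be a Gauss map of $\Sigma$, in either of the two orientations. Assume that $\Sigma$ is a compact oriented surface with boundary $\Gamma$ in the sense that it has a smooth cellulation, by finitely many positively oriented quadrilaterals immersed up to their boundary and with disjoint interiors, whose sides cancel out in the chain boundary except for sides lying on $\Gamma$; let $S$ be the corresponding chain (the fundamental class of $\Sigma$ relative to $\Gamma$). Let $Y=\overline U\times\mathbb R v=\{x+tv:\ x\in\overline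 U,\ t\in\mathbb R\}$. Chains are smooth singular cubical chains with integer coefficients, modulo degenerate cubes. For a $2$-chain $T=\sum_i a_i\sigma_i$ with distinct $\sigma_i$, its weighted area is $A_\phi(T)=\sum_i|a_i|\int_{[0,1]^2}e^{\phi\circ\sigma_i}\,|\partial_1\sigma_i\times\partial_2\sigma_i|$; for a $3$-chain $Q=\sum_i b_iq_i$ its weighted volume is $V_\phi(Q)=\sum_i b_i\int_{[0,1]^3}e^{\phi\circ q_i}\det Dq_i$. A compact oriented surface, embedded or immersed, is identified with the chain of a smooth cellulation of it; then $A_\phi$ is its weighted area. Let $\mathcal C$ be the class of all $2$-chains $T$ in $Y$ (in particular, all compact oriented surfaces in $Y$) with the same boundary, homology class and weighted volume as $\Sigma$: there is a $3$-chain $Q$ in $Y$ such that $T-S-\partial Q$ is a chain in $\Gamma$ (so that $T$ and $S$ have the same class in $H_2(Y,\Gamma)$) and $V_\phi(Q)=0$. **Theorem.** If $\Sigma$ is a translating $\lambda$-soliton, i.e. $H=\langle N,v\rangle+\lambda$ at the points of $\Sigma$ over $U$, then $\Sigma$ minimizes the weighted area in $\mathcal C$: $S\in\mathcal C$, and $$A_\phi(\Sigma)=A_\phi(S)\le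 A_\phi(T)\qquad\text{for all }T\in\mathcal C .$$ -/

import Mathlib

open scoped ContDiff

noncomputable section

namespace TranslatingSoliton

/-- Euclidean three-space. -/
abbrev E3 : Type := EuclideanSpace ℝ (Fin 3)

/-- The determinant `det (a, b, c) = ⟨a × b, c⟩` of three vectors of `ℝ³`. -/
def det3 (a b c : E3) : ℝ :=
  (EuclideanSpace.basisFun (Fin 3) ℝ).toBasis.det ![a, b, c]

/-! ### Smooth singular cubical chains in `ℝ³` -/

/-- The closed unit cube `[0,1]ⁿ`. -/
def unitCube (n : ℕ) : Set (Fin n → ℝ) := Set.Icc 0 1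

/-- A smooth singular `n`-cube of `ℝ³`: a map `[0,1]ⁿ → ℝ³` that is smooth up to the boundary.
It is stored as a function on `ℝⁿ` that vanishes off the unit cube, so that two cubes are equal
exactly when they agree as maps on `[0,1]ⁿ`. -/
@[ext]
structure SmoothCube (n : ℕ) where
  toFun : (Fin n → ℝ) → E3
  smooth : ContDiffOn ℝ ∞ toFun (unitCube n)
  eq_zero : ∀ x, x ∉ unitCube n → toFun x = 0

namespace SmoothCube

variable {n : ℕ}

/-- The image of the cube. -/
def image (σ : SmoothCube n) : Set E3 := σ.toFun '' unitCube n

/-- The `i`-th partial derivative (one-sided at the boundary of the cube). -/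
def partialDeriv (σ : SmoothCube n) (i : Fin n) (x : Fin n → ℝ) : E3 :=
  fderivWithin ℝ σ.toFun (unitCube n) x (Pi.single i 1)

/-- The cube does not depend on one of its coordinates. -/
def IsDegenerate (σ : SmoothCube n) : Prop :=
  ∃ i : Fin n, ∀ x ∈ unitCube n, ∀ y ∈ unitCube n,
    (∀ j, j ≠ i → x j = y j) → σ.toFun x = σ.toFun y

end SmoothCube

theorem insertNth_mem_unitCube {n : ℕ} (i : Fin (n + 1)) {c : ℝ} (hc : c ∈ Set.Icc (0 : ℝ) 1)
    (y : Fin n → ℝ) : i.insertNth c y ∈ unitCube (n + 1) ↔ y ∈ unitCube n := by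
  simp only [unitCube, Set.mem_Icc, Pi.le_def]
  rw [Fin.forall_iff_succAbove i, Fin.forall_iff_succAbove i]
  simp [hc.1, hc.2]

namespace SmoothCube

/-- The face of a cube on which the `i`-th coordinate equals `c`, for `c ∈ [0,1]`. -/
def face {n : ℕ} (σ : SmoothCube (n + 1)) (i : Fin (n + 1)) (c : ℝ)
    (hc : c ∈ Set.Icc (0 : ℝ) 1) : SmoothCube n where
  toFun := fun y => σ.toFun (i.insertNth c y)
  smooth := by
    refine σ.smooth.comp (g := σ.toFun) (f := fun y : Fin n → ℝ => i.insertNth c y) ?_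
      (fun y hy => (insertNth_mem_unitCube i hc y).2 hy)
    refine (contDiff_pi.2 fun j => ?_).contDiffOn
    rcases Fin.eq_self_or_eq_succAbove i j with h | ⟨k, h⟩
    · subst h
      simpa using contDiff_const
    · subst h
      simpa using contDiff_apply ℝ ℝ k
  eq_zero := fun y hy => σ.eq_zero _ fun h => hy ((insertNth_mem_unitCube i hc y).1 h)

/-- The face on which the `i`-th coordinate is `0`. -/
def backFace {n : ℕ} (σ : SmoothCube (n + 1)) (i : Fin (n + 1)) : SmoothCube n :=
  σ.face i 0 ⟨le_rfl, zero_le_one⟩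

/-- The face on which the `i`-th coordinate is `1`. -/
def frontFace {n : ℕ} (σ : SmoothCube (n + 1)) (i : Fin (n + 1)) : SmoothCube n :=
  σ.face i 1 ⟨zero_le_one, le_rfl⟩

end SmoothCube

/-- Smooth singular cubical `n`-chains of `ℝ³` with integer coefficients. -/
abbrev CubeChain (n : ℕ) : Type := SmoothCube n →₀ ℤ

/-- The boundary operator
`∂ σ = ∑ i, (-1) ^ i • (σ restricted to xᵢ = 1, minus σ restricted to xᵢ = 0)`
(coordinates are numbered from `0`). -/
def boundary {n : ℕ} (c : CubeChain (n + 1)) : CubeChain n :=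
  c.sum fun σ a => ∑ i : Fin (n + 1), ((-1 : ℤ) ^ (i : ℕ) * a) •
    (Finsupp.single (σ.frontFace i) 1 - Finsupp.single (σ.backFace i) 1)

/-- All cubes of the chain lie in the set `Y`. -/
def IsChainIn {n : ℕ} (Y : Set E3) (c : CubeChain n) : Prop :=
  ∀ σ ∈ c.support, σ.image ⊆ Y

/-- The chain vanishes in the group of normalized cubical chains relative to `B`: it is a
combination of degenerate cubes and of cubes that lie in `B`. -/
def IsZeroRel {n : ℕ} (B : Set E3) (c : CubeChain n) : Prop :=
  ∀ σ ∈ c.support, σ.IsDegenerate ∨ σ.image ⊆ B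

/-- `Q` is an `(n+1)`-chain in `Y` with `∂Q = T - S` in the chains of the pair `(Y, B)`. When such
a `Q` exists and `∂S` lies in `B`, the chains `S` and `T` define the same class in `Hₙ(Y, B)`;
their boundaries then define the same class in `Hₙ₋₁(B)`. -/
def IsHomologyBetween {n : ℕ} (Y B : Set E3) (S T : CubeChain n) (Q : CubeChain (n + 1)) : Prop :=
  IsChainIn Y Q ∧ IsZeroRel B (T - S - boundary Q)

/-! ### Weighted area and weighted volume, for the density `φ(x) = ⟨x, v⟩` -/

/-- The weighted area `∫ e^φ dA` of a parametrized piece of surface, where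
`dA = √(|σ₀|² |σ₁|² - ⟨σ₀, σ₁⟩²)` and `σ₀, σ₁` are the partial derivatives. -/
def cubeArea (v : E3) (σ : SmoothCube 2) : ℝ :=
  ∫ x in unitCube 2, Real.exp (inner ℝ (σ.toFun x) v) *
    Real.sqrt (‖σ.partialDeriv 0 x‖ ^ 2 * ‖σ.partialDeriv 1 x‖ ^ 2
      - inner ℝ (σ.partialDeriv 0 x) (σ.partialDeriv 1 x) ^ 2)

/-- The weighted area `A_φ` of a `2`-chain, counted with multiplicity. -/
def weightedArea (v : E3) (T : CubeChain 2) : ℝ :=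
  T.sum fun σ a => |(a : ℝ)| * cubeArea v σ

/-- The weighted oriented volume `∫ e^φ dV` of a singular `3`-cube. -/
def cubeVolume (v : E3) (q : SmoothCube 3) : ℝ :=
  ∫ x in unitCube 3, Real.exp (inner ℝ (q.toFun x) v) *
    det3 (q.partialDeriv 0 x) (q.partialDeriv 1 x) (q.partialDeriv 2 x)

/-- The weighted oriented volume `∫_Q dV_φ` of a `3`-chain. -/
def weightedVolume (v : E3) (Q : CubeChain 3) : ℝ :=
  Q.sum fun q a => (a : ℝ) * cubeVolume v q

/-! ### Parametrized surfaces, Gauss map, mean curvature, translating solitons -/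

section Surfaces

variable {P : Type*} [NormedAddCommGroup P] [NormedSpace ℝ P]

/-- `N` is a Gauss map (continuous unit normal field) of the surface `F '' D` parametrized by
`F`. Only the values of `N` on the surface matter. -/
structure IsGaussMap (F : P → E3) (D : Set P) (N : E3 → E3) : Prop where
  continuousOn : ContinuousOn N (F '' D)
  norm_eq_one : ∀ x ∈ D, ‖N (F x)‖ = 1
  orthogonal : ∀ x ∈ D, ∀ a : P, inner ℝ (fderiv ℝ F x a) (N (F x)) = 0

/-- The mean curvature at `F x` of the surface parametrized by the immersion `F`, with respect to
its Gauss map `N`, is `H`: this is the trace (the sum of the principal curvatures) of the shape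
operator `A`, the linear map determined by `d(N ∘ F) = - dF ∘ A`. -/
def HasMeanCurvatureAt (F : P → E3) (N : E3 → E3) (x : P) (H : ℝ) : Prop :=
  Function.Injective (fderiv ℝ F x) ∧ DifferentiableAt ℝ (N ∘ F) x ∧
    ∃ A : P →ₗ[ℝ] P, (∀ a, fderiv ℝ (N ∘ F) x a = -fderiv ℝ F x (A a)) ∧
      LinearMap.trace ℝ P A = H

/-- The soliton equation `H = ⟨N, v⟩ + lam` on `F '' D`. -/
def SolitonEquation (v : E3) (lam : ℝ) (F : P → E3) (D : Set P) (N : E3 → E3) : Prop :=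
  ∀ x ∈ D, HasMeanCurvatureAt F N x (inner ℝ (N (F x)) v + lam)

end Surfaces

/-- `S` is the chain of a smooth cellulation, into quadrilaterals, of the compact embedded surface
`M` with boundary `B` that is oriented by its Gauss map `N`. The cells are immersed up to their
boundary, they cover `M`, an interior point of a cell lies on no other cell, all cells (with the
sign `S σ`) are positively oriented, and the sides of the cells cancel out except for those on `B`.
So `S` is a relative cycle that represents the fundamental class of `(M, B)`. -/
structure IsCellulation (M B : Set E3) (N : E3 → E3) (S : CubeChain 2) : Prop where
  sign : ∀ σ ∈ S.support, S σ = 1 ∨ S σ = -1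
  cover : ⋃ σ ∈ S.support, σ.image = M
  oriented : ∀ σ ∈ S.support, ∀ x ∈ unitCube 2,
    0 < (S σ : ℝ) * det3 (σ.partialDeriv 0 x) (σ.partialDeriv 1 x) (N (σ.toFun x))
  injective : ∀ σ ∈ S.support, ∀ τ ∈ S.support, ∀ x ∈ interior (unitCube 2), ∀ y ∈ unitCube 2,
    σ.toFun x = τ.toFun y → σ = τ ∧ x = y
  boundary_subset : IsChainIn B (boundary S)

/-! ### Graphs over domains of the plane `v^⊥` -/

/-- The vector plane orthogonal to `v`. -/
abbrev plane (v : E3) : Submodule ℝ E3 := (Submodule.span ℝ {v})ᗮ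

/-- The parametrization `x ↦ x + u(x) v` of the graph of `u`. -/
def graphMap (v : E3) (u : plane v → ℝ) (x : plane v) : E3 := (x : E3) + u x • v

/-- The cylinder `D × ℝv`. -/
def cylinder (v : E3) (D : Set (plane v)) : Set E3 :=
  {p | ∃ x ∈ D, ∃ t : ℝ, p = (x : E3) + t • v}

/-- The comparison class of a surface with fundamental chain `S` and boundary curve `B`, inside
`Y`: the smooth `2`-chains `T` in `Y` which have the same boundary and homology class as `S` (that
is, the same class in `H₂(Y, B)`) and the same weighted volume, in the sense that the `3`-chain
between `S` and `T` has weighted volume zero. Every compact oriented surface in `Y`, embedded or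
only immersed, gives such a `T` through a smooth cellulation. -/
def comparisonClass (v : E3) (Y B : Set E3) (S : CubeChain 2) : Set (CubeChain 2) :=
  {T | IsChainIn Y T ∧ ∃ Q : CubeChain 3, IsHomologyBetween Y B S T Q ∧ weightedVolume v Q = 0}

end TranslatingSoliton

end

open TranslatingSoliton

namespace TranslatingSoliton

open MeasureTheory

/-! ### The determinant of three vectors -/

/-! The proof is a calibration argument. Extend the Gauss map of the graph to a unit field ξ on the
cylinder, constant along `v`, and put X = e^φ ξ. Then div X = e^φ (⟨ξ, v⟩ + div ξ)
(`trace_fderiv_weightedField`). Since ξ is constant along `v`, div ξ at a point is minus the mean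
curvature of the graph below or above it. The soliton equation thus says div X = -λ e^φ over `U`,
and over `closure U` by continuity (`inner_add_trace_eq_of_soliton_closure`).

By Stokes (`chainFlux_boundary`), the fluxes of X through `T` and `S` differ by -λ V_φ(Q) = 0 plus
the flux through a chain of degenerate cubes and cubes in Γ. That last flux also vanishes
(`chainFlux_eq_zero_of_isZeroRel`). No regularity of Γ is needed, as the frontier of an open set has
empty interior, so a smooth cube in Γ has rank less than two everywhere.

Finally ξ is a unit field, so flux is at most area (`chainFlux_le_weightedArea`), with equality on
`S`, where ξ is the oriented normal (`weightedArea_eq_chainFlux`). -/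

theorem det3_eq (a b c : E3) :
    det3 a b c = a 0 * b 1 * c 2 - a 0 * b 2 * c 1 - a 1 * b 0 * c 2 + a 1 * b 2 * c 0
      + a 2 * b 0 * c 1 - a 2 * b 1 * c 0 := by
  simp only [det3, Module.Basis.det_apply, Matrix.det_fin_three, Module.Basis.toMatrix_apply,
    OrthonormalBasis.coe_toBasis_repr_apply, EuclideanSpace.basisFun_repr]
  simp only [Matrix.cons_val]
  ring

theorem inner_eq_sum (a b : E3) : inner ℝ a b = a 0 * b 0 + a 1 * b 1 + a 2 * b 2 := by
  simp [PiLp.inner_apply, Fin.sum_univ_three, mul_comm]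

theorem det3_smul_right (a b c : E3) (r : ℝ) : det3 a b (r • c) = r * det3 a b c := by
  simp only [det3_eq, PiLp.smul_apply, smul_eq_mul]
  ring

theorem det3_eq_zero_of_smul_add_smul_eq_zero {a b : E3} {r s : ℝ} (h : r • a + s • b = 0)
    (hrs : r ≠ 0 ∨ s ≠ 0) (c : E3) : det3 a b c = 0 := by
  have h' : ∀ i, r * a i + s * b i = 0 := fun i => by simpa using congrArg (fun z : E3 => z i) h
  have h0 := h' 0
  have h1 := h' 1
  have h2 := h' 2
  have hr : r * det3 a b c = 0 := by
    rw [det3_eq]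
    linear_combination (b 1 * c 2 - b 2 * c 1) * h0 + (b 2 * c 0 - b 0 * c 2) * h1
      + (b 0 * c 1 - b 1 * c 0) * h2
  have hs : s * det3 a b c = 0 := by
    rw [det3_eq]
    linear_combination (a 2 * c 1 - a 1 * c 2) * h0 + (a 0 * c 2 - a 2 * c 0) * h1
      + (a 1 * c 0 - a 0 * c 1) * h2
  rcases hrs with h | h
  · exact (mul_eq_zero.1 hr).resolve_left h
  · exact (mul_eq_zero.1 hs).resolve_left h

/-- The area of the parallelogram spanned by two vectors, from the Gram determinant. -/
theorem det3_sq_add_sq_eq (a b c : E3) (hc : ‖c‖ = 1) :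
    det3 a b c ^ 2 + ‖inner ℝ a c • b - inner ℝ b c • a‖ ^ 2
      = ‖a‖ ^ 2 * ‖b‖ ^ 2 - inner ℝ a b ^ 2 := by
  have hc' : c 0 * c 0 + c 1 * c 1 + c 2 * c 2 = 1 := by
    rw [← inner_eq_sum, real_inner_self_eq_norm_sq, hc, one_pow]
  simp only [← real_inner_self_eq_norm_sq, inner_eq_sum, det3_eq, PiLp.sub_apply, PiLp.smul_apply,
    smul_eq_mul]
  linear_combination ((a 0 * b 1 - a 1 * b 0) ^ 2 + (a 0 * b 2 - a 2 * b 0) ^ 2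
    + (a 1 * b 2 - a 2 * b 1) ^ 2) * hc'

theorem abs_det3_le (a b c : E3) (hc : ‖c‖ = 1) :
    |det3 a b c| ≤ Real.sqrt (‖a‖ ^ 2 * ‖b‖ ^ 2 - inner ℝ a b ^ 2) := by
  rw [← det3_sq_add_sq_eq a b c hc]
  exact Real.abs_le_sqrt (le_add_of_nonneg_right (sq_nonneg _))

theorem abs_det3_eq (a b c : E3) (hc : ‖c‖ = 1) (ha : inner ℝ a c = 0) (hb : inner ℝ b c = 0) :
    |det3 a b c| = Real.sqrt (‖a‖ ^ 2 * ‖b‖ ^ 2 - inner ℝ a b ^ 2) := by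
  rw [← det3_sq_add_sq_eq a b c hc, ha, hb, ← Real.sqrt_sq_eq_abs]
  simp

/-- This is the derivative at t = 0 of det(1 + tL) · det(a, b, c), with the differentiated vector
moved to the last slot. It turns the divergence of a pulled-back field into the trace of its
derivative. -/
theorem det3_trace (L : E3 →ₗ[ℝ] E3) (a b c : E3) :
    det3 b c (L a) - det3 a c (L b) + det3 a b (L c) = LinearMap.trace ℝ E3 L * det3 a b c := by
  have hL : ∀ (z : E3) (i : Fin 3), L z i = z 0 * L (EuclideanSpace.single 0 1) i
      + z 1 * L (EuclideanSpace.single 1 1) i + z 2 * L (EuclideanSpace.single 2 1) i := by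
    intro z i
    have hz : z = z 0 • EuclideanSpace.single 0 (1 : ℝ) + z 1 • EuclideanSpace.single 1 (1 : ℝ)
        + z 2 • EuclideanSpace.single 2 (1 : ℝ) := by
      ext j
      fin_cases j <;> simp
    conv_lhs => rw [hz]
    simp
  have htr : LinearMap.trace ℝ E3 L = L (EuclideanSpace.single 0 1) 0
      + L (EuclideanSpace.single 1 1) 1 + L (EuclideanSpace.single 2 1) 2 := by
    rw [LinearMap.trace_eq_matrix_trace ℝ (EuclideanSpace.basisFun (Fin 3) ℝ).toBasis]
    simp [Matrix.trace, Fin.sum_univ_three, LinearMap.toMatrix_apply]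
  rw [htr]
  simp only [det3_eq, hL a, hL b, hL c]
  ring

theorem hasFDerivAt_det3 {G : Type*} [NormedAddCommGroup G] [NormedSpace ℝ G] {a b c : G → E3}
    {a' b' c' : G →L[ℝ] E3} {x : G} (ha : HasFDerivAt a a' x) (hb : HasFDerivAt b b' x)
    (hc : HasFDerivAt c c' x) :
    ∃ D : G →L[ℝ] ℝ, HasFDerivAt (fun y => det3 (a y) (b y) (c y)) D x ∧
      ∀ w, D w = det3 (a' w) (b x) (c x) + det3 (a x) (b' w) (c x) + det3 (a x) (b x) (c' w) := by
  have coord : ∀ {f : G → E3} {f' : G →L[ℝ] E3}, HasFDerivAt f f' x → ∀ i : Fin 3,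
      HasFDerivAt (fun y => f y i) ((EuclideanSpace.proj i : E3 →L[ℝ] ℝ) ∘L f') x :=
    fun hf i => (EuclideanSpace.proj i : E3 →L[ℝ] ℝ).hasFDerivAt.comp x hf
  have term : ∀ i j k : Fin 3, HasFDerivAt (fun y => a y i * b y j * c y k) _ x :=
    fun i j k => ((coord ha i).mul (coord hb j)).mul (coord hc k)
  have key := ((((((term 0 1 2).sub (term 0 2 1)).sub (term 1 0 2)).add (term 1 2 0)).add
    (term 2 0 1)).sub (term 2 1 0))
  refine ⟨_, key.congr_of_eventuallyEq (.of_forall fun y => ?_), fun w => ?_⟩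
  · simp [det3_eq]
  · simp [det3_eq]
    ring

theorem continuousOn_det3 {G : Type*} [TopologicalSpace G] {a b c : G → E3} {s : Set G}
    (ha : ContinuousOn a s) (hb : ContinuousOn b s) (hc : ContinuousOn c s) :
    ContinuousOn (fun y => det3 (a y) (b y) (c y)) s := by
  simp only [det3_eq]
  have coord : ∀ {f : G → E3}, ContinuousOn f s → ∀ i : Fin 3, ContinuousOn (fun y => f y i) s :=
    fun hf i => (EuclideanSpace.proj i : E3 →L[ℝ] ℝ).continuous.comp_continuousOn hf
  have term : ∀ i j k : Fin 3, ContinuousOn (fun y => a y i * b y j * c y k) s :=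
    fun i j k => ((coord ha i).mul (coord hb j)).mul (coord hc k)
  exact (((((term 0 1 2).sub (term 0 2 1)).sub (term 1 0 2)).add (term 1 2 0)).add
    (term 2 0 1)).sub (term 2 1 0)

/-! ### Calculus on smooth cubes -/

theorem two_le_infty : (2 : WithTop ℕ∞) ≤ ∞ :=
  WithTop.coe_le_coe.2 (le_top : (2 : ℕ∞) ≤ ⊤)

theorem interior_unitCube (n : ℕ) :
    interior (unitCube n) = Set.univ.pi fun _ => Set.Ioo (0 : ℝ) 1 := by
  rw [unitCube, ← Set.pi_univ_Icc, interior_pi_set Set.finite_univ]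
  simp

theorem interior_unitCube_nonempty (n : ℕ) : (interior (unitCube n)).Nonempty := by
  rw [interior_unitCube]
  exact ⟨fun _ => 1 / 2, fun _ _ => by norm_num⟩

theorem isCompact_unitCube (n : ℕ) : IsCompact (unitCube n) := isCompact_Icc

theorem measurableSet_unitCube (n : ℕ) : MeasurableSet (unitCube n) := measurableSet_Icc

theorem convex_unitCube (n : ℕ) : Convex ℝ (unitCube n) := convex_Icc _ _

theorem uniqueDiffOn_unitCube (n : ℕ) : UniqueDiffOn ℝ (unitCube n) :=
  uniqueDiffOn_convex (convex_unitCube n) (interior_unitCube_nonempty n)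

theorem closure_interior_unitCube (n : ℕ) : closure (interior (unitCube n)) = unitCube n := by
  rw [(convex_unitCube n).closure_interior_eq_closure_of_nonempty_interior
    (interior_unitCube_nonempty n)]
  exact (isCompact_unitCube n).isClosed.closure_eq

/-- A continuous function on the cube that vanishes in the interior vanishes. -/
theorem eq_zero_of_eq_zero_on_interior {n : ℕ} {f : (Fin n → ℝ) → ℝ}
    (hf : ContinuousOn f (unitCube n)) (h : ∀ x ∈ interior (unitCube n), f x = 0) :
    ∀ x ∈ unitCube n, f x = 0 :=
  Set.EqOn.of_subset_closure (g := fun _ => 0) h hf continuousOn_const interior_subset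
    (closure_interior_unitCube n).ge

namespace SmoothCube

variable {n : ℕ}

theorem continuousOn (σ : SmoothCube n) : ContinuousOn σ.toFun (unitCube n) :=
  σ.smooth.continuousOn

theorem differentiableWithinAt (σ : SmoothCube n) {x : Fin n → ℝ} (hx : x ∈ unitCube n) :
    DifferentiableWithinAt ℝ σ.toFun (unitCube n) x :=
  σ.smooth.differentiableOn (by simp) x hx

theorem continuousOn_partialDeriv (σ : SmoothCube n) (i : Fin n) :
    ContinuousOn (σ.partialDeriv i) (unitCube n) :=
  (σ.smooth.continuousOn_fderivWithin (uniqueDiffOn_unitCube n) (by simp)).clm_apply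
    continuousOn_const

theorem contDiffAt (σ : SmoothCube n) {x : Fin n → ℝ} (hx : x ∈ interior (unitCube n)) :
    ContDiffAt ℝ ∞ σ.toFun x :=
  σ.smooth.contDiffAt (mem_interior_iff_mem_nhds.1 hx)

theorem partialDeriv_of_mem_interior (σ : SmoothCube n) (i : Fin n) {x : Fin n → ℝ}
    (hx : x ∈ interior (unitCube n)) :
    σ.partialDeriv i x = fderiv ℝ σ.toFun x (Pi.single i 1) := by
  rw [partialDeriv, fderivWithin_of_mem_nhds (mem_interior_iff_mem_nhds.1 hx)]

theorem hasFDerivAt_partialDeriv (σ : SmoothCube n) (i : Fin n) {x : Fin n → ℝ}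
    (hx : x ∈ interior (unitCube n)) :
    HasFDerivAt (σ.partialDeriv i)
      ((ContinuousLinearMap.apply ℝ E3 (Pi.single i 1)) ∘L fderiv ℝ (fderiv ℝ σ.toFun) x) x := by
  have h1 : DifferentiableAt ℝ (fderiv ℝ σ.toFun) x :=
    ((σ.contDiffAt hx).fderiv_right (m := 1) (one_add_one_eq_two.trans_le two_le_infty)).differentiableAt (by simp)
  refine ((ContinuousLinearMap.apply ℝ E3 (Pi.single i 1)).hasFDerivAt.comp x
    h1.hasFDerivAt).congr_of_eventuallyEq ?_
  filter_upwards [isOpen_interior.mem_nhds hx] with y hy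
  simpa using σ.partialDeriv_of_mem_interior i hy

theorem fderiv_fderiv_comm (σ : SmoothCube n) {x : Fin n → ℝ} (hx : x ∈ interior (unitCube n))
    (a b : Fin n → ℝ) :
    fderiv ℝ (fderiv ℝ σ.toFun) x a b = fderiv ℝ (fderiv ℝ σ.toFun) x b a :=
  ((σ.contDiffAt hx).isSymmSndFDerivAt (by simpa using two_le_infty)) a b

/-- Inserting a coordinate is affine and maps cube to cube, so the chain rule holds for one-sided
derivatives, even when the face lies in the boundary. -/
theorem partialDeriv_face (σ : SmoothCube (n + 1)) (i : Fin (n + 1)) {c : ℝ}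
    (hc : c ∈ Set.Icc (0 : ℝ) 1) (j : Fin n) {y : Fin n → ℝ} (hy : y ∈ unitCube n) :
    (σ.face i c hc).partialDeriv j y = σ.partialDeriv (i.succAbove j) (i.insertNth c y) := by
  have hins : HasFDerivAt (fun y : Fin n → ℝ => (i.insertNth c y : Fin (n + 1) → ℝ))
      (ContinuousLinearMap.pi fun k => i.insertNth (α := fun _ => (Fin n → ℝ) →L[ℝ] ℝ) 0
        (fun k' => ContinuousLinearMap.proj k') k) y := by
    rw [hasFDerivAt_pi]
    intro k
    rcases Fin.eq_self_or_eq_succAbove i k with h | ⟨k', h⟩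
    · subst h
      simpa using hasFDerivAt_const c y
    · subst h
      simpa using hasFDerivAt_apply k' y
  have hmem := (insertNth_mem_unitCube i hc y).2 hy
  have hcomp := (σ.differentiableWithinAt hmem).hasFDerivWithinAt.comp y hins.hasFDerivWithinAt
    (fun z hz => (insertNth_mem_unitCube i hc z).2 hz)
  have : fderivWithin ℝ (σ.face i c hc).toFun (unitCube n) y = _ :=
    hcomp.fderivWithin (uniqueDiffOn_unitCube n y hy)
  rw [partialDeriv, this, partialDeriv]
  simp only [ContinuousLinearMap.comp_apply]
  congr 1
  ext k
  rcases Fin.eq_self_or_eq_succAbove i k with h | ⟨k', h⟩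
  · subst h
    simp
  · subst h
    simp [Pi.single_apply]

end SmoothCube

/-! ### Flux of a vector field through a cube -/

/-- The flux of the vector field `X` through a singular `2`-cube. -/
noncomputable def flux (X : E3 → E3) (σ : SmoothCube 2) : ℝ :=
  ∫ x in unitCube 2, det3 (σ.partialDeriv 0 x) (σ.partialDeriv 1 x) (X (σ.toFun x))

/-- The flux of the vector field `X` through a `2`-chain. -/
noncomputable def chainFlux (X : E3 → E3) : CubeChain 2 →+ ℝ :=
  Finsupp.liftAddHom fun σ => (AddMonoidHom.mulRight (flux X σ)).comp (Int.castAddHom ℝ)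

theorem chainFlux_apply (X : E3 → E3) (T : CubeChain 2) :
    chainFlux X T = T.sum fun σ a => (a : ℝ) * flux X σ := rfl

/-- The divergence theorem on a singular cube. -/
theorem integral_trace_fderiv_eq_flux (X : E3 → E3) (q : SmoothCube 3)
    (hX : ∀ p ∈ q.image, ContDiffAt ℝ 1 X p) :
    ∫ x in unitCube 3, LinearMap.trace ℝ E3 (fderiv ℝ X (q.toFun x)) *
        det3 (q.partialDeriv 0 x) (q.partialDeriv 1 x) (q.partialDeriv 2 x)
      = ∑ i : Fin 3, (-1 : ℝ) ^ (i : ℕ) * (flux X (q.frontFace i) - flux X (q.backFace i)) := by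
  have hX' : ∀ x ∈ unitCube 3, ContDiffAt ℝ 1 X (q.toFun x) := fun x hx =>
    hX _ (Set.mem_image_of_mem _ hx)
  have hXq : ContinuousOn (fun x => X (q.toFun x)) (unitCube 3) := fun x hx =>
    (hX' x hx).continuousAt.comp_continuousWithinAt (q.continuousOn x hx)
  -- The 2-form det(·, ·, X) is pulled back by `q`; its coefficients, signed by the omitted index,
  -- form a vector field `F` on the cube, to which the divergence theorem on a box applies.
  let g : Fin 3 → Fin 3 → (Fin 3 → ℝ) → ℝ := fun i j x =>
    det3 (q.partialDeriv i x) (q.partialDeriv j x) (X (q.toFun x))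
  let F : (Fin 3 → ℝ) → Fin 3 → ℝ := fun x => ![g 1 2 x, -g 0 2 x, g 0 1 x]
  have hg : ∀ i j, ContinuousOn (g i j) (unitCube 3) := fun i j =>
    continuousOn_det3 (q.continuousOn_partialDeriv i) (q.continuousOn_partialDeriv j) hXq
  have hF : ContinuousOn F (unitCube 3) := by
    rw [continuousOn_pi]
    intro i
    fin_cases i
    · exact hg 1 2
    · exact (hg 0 2).neg
    · exact hg 0 1
  have hDX : ContinuousOn (fun x => LinearMap.trace ℝ E3 (fderiv ℝ X (q.toFun x)).toLinearMap)
      (unitCube 3) := by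
    intro x hx
    have h1 : ContinuousAt (fderiv ℝ X) (q.toFun x) :=
      ((hX' x hx).fderiv_right (m := 0) (by simp)).continuousAt
    have h2 : Continuous fun L : E3 →L[ℝ] E3 => LinearMap.trace ℝ E3 L.toLinearMap :=
      LinearMap.continuous_of_finiteDimensional
        ((LinearMap.trace ℝ E3) ∘ₗ (ContinuousLinearMap.coeLM ℝ))
    exact (h2.continuousAt.comp h1).comp_continuousWithinAt (q.continuousOn x hx)
  have hdiv : ContinuousOn (fun x => LinearMap.trace ℝ E3 (fderiv ℝ X (q.toFun x)).toLinearMap *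
      det3 (q.partialDeriv 0 x) (q.partialDeriv 1 x) (q.partialDeriv 2 x)) (unitCube 3) :=
    hDX.mul (continuousOn_det3 (q.continuousOn_partialDeriv 0) (q.continuousOn_partialDeriv 1)
      (q.continuousOn_partialDeriv 2))
  have hderiv : ∀ x ∈ interior (unitCube 3), ∃ D : (Fin 3 → ℝ) →L[ℝ] (Fin 3 → ℝ),
      HasFDerivAt F D x ∧ ∑ i, D (Pi.single i 1) i
        = LinearMap.trace ℝ E3 (fderiv ℝ X (q.toFun x)).toLinearMap *
      det3 (q.partialDeriv 0 x) (q.partialDeriv 1 x) (q.partialDeriv 2 x) := by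
    intro x hx
    have hqx := ((q.contDiffAt hx).differentiableAt (by simp)).hasFDerivAt
    have hXx := ((hX' x (interior_subset hx)).differentiableAt one_ne_zero).hasFDerivAt.comp x hqx
    obtain ⟨D0, hD0, hw0⟩ := hasFDerivAt_det3 (q.hasFDerivAt_partialDeriv 1 hx)
      (q.hasFDerivAt_partialDeriv 2 hx) hXx
    obtain ⟨D1, hD1, hw1⟩ := hasFDerivAt_det3 (q.hasFDerivAt_partialDeriv 0 hx)
      (q.hasFDerivAt_partialDeriv 2 hx) hXx
    obtain ⟨D2, hD2, hw2⟩ := hasFDerivAt_det3 (q.hasFDerivAt_partialDeriv 0 hx)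
      (q.hasFDerivAt_partialDeriv 1 hx) hXx
    refine ⟨ContinuousLinearMap.pi ![D0, -D1, D2], ?_, ?_⟩
    · rw [hasFDerivAt_pi]
      intro i
      fin_cases i
      · exact hD0
      · exact hD1.neg
      · exact hD2
    · rw [← det3_trace]
      simp only [Fin.sum_univ_three, ContinuousLinearMap.coe_pi', Matrix.cons_val,
        neg_apply, hw0, hw1, hw2, ContinuousLinearMap.comp_apply,
        ContinuousLinearMap.apply_apply, ContinuousLinearMap.coe_coe, Function.comp_apply,
        q.partialDeriv_of_mem_interior _ hx]
      -- The terms with second derivatives of `q` cancel in pairs by symmetry, which leaves only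
      -- those with the derivative of X.
      rw [q.fderiv_fderiv_comm hx (Pi.single 1 1) (Pi.single 0 1),
        q.fderiv_fderiv_comm hx (Pi.single 2 1) (Pi.single 0 1),
        q.fderiv_fderiv_comm hx (Pi.single 2 1) (Pi.single 1 1)]
      simp only [det3_eq]
      ring
  have hint : interior (unitCube 3) =ᵐ[volume] unitCube 3 := by
    rw [interior_unitCube, unitCube]
    exact Measure.univ_pi_Ioo_ae_eq_Icc
  choose! D hD hDsum using hderiv
  have hcongr : ∀ᵐ x ∂volume.restrict (unitCube 3), ∑ i, D x (Pi.single i 1) i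
      = LinearMap.trace ℝ E3 (fderiv ℝ X (q.toFun x)).toLinearMap *
      det3 (q.partialDeriv 0 x) (q.partialDeriv 1 x) (q.partialDeriv 2 x) := by
    rw [← Measure.restrict_congr_set hint]
    exact (ae_restrict_mem isOpen_interior.measurableSet).mono hDsum
  have key := integral_divergence_of_hasFDerivAt_off_countable (0 : Fin 3 → ℝ) 1 zero_le_one F D ∅
    Set.countable_empty hF (fun x hx => hD x (by rw [interior_unitCube]; exact hx.1))
    ((hdiv.integrableOn_compact (isCompact_unitCube 3)).congr_fun_ae
      (hcongr.mono fun _ h => h.symm))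
  have hface : ∀ (i : Fin 3) (c : ℝ) (hc : c ∈ Set.Icc (0 : ℝ) 1),
      ∫ y in unitCube 2, F (i.insertNth c y) i = (-1 : ℝ) ^ (i : ℕ) * flux X (q.face i c hc) := by
    intro i c hc
    rw [flux, ← integral_const_mul]
    refine setIntegral_congr_fun (measurableSet_unitCube 2) fun y hy => ?_
    simp only [q.partialDeriv_face i hc _ hy]
    fin_cases i
    · simp [F, g, SmoothCube.face]
    · simp [F, g, SmoothCube.face]
    · have h21 : Fin.succAbove (2 : Fin 3) 1 = 1 := rfl
      simp [F, g, SmoothCube.face, h21]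
  rw [← integral_congr_ae hcongr]
  refine key.trans (Finset.sum_congr rfl fun i _ => ?_)
  rw [mul_sub]
  exact congrArg₂ (· - ·) (hface i 1 _) (hface i 0 _)

/-- Stokes' theorem for a vector field whose divergence is a multiple of the density. -/
theorem chainFlux_boundary (v : E3) (X : E3 → E3) (r : ℝ) (Y : Set E3)
    (hX : ∀ p ∈ Y, ContDiffAt ℝ 1 X p)
    (hdiv : ∀ p ∈ Y, LinearMap.trace ℝ E3 (fderiv ℝ X p).toLinearMap
      = r * Real.exp (inner ℝ p v))
    (Q : CubeChain 3) (hQ : IsChainIn Y Q) :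
    chainFlux X (boundary Q) = r * weightedVolume v Q := by
  rw [boundary, map_finsuppSum, weightedVolume, Finsupp.mul_sum]
  refine Finset.sum_congr rfl fun q hq => ?_
  have key := integral_trace_fderiv_eq_flux X q fun p hp => hX p (hQ q hq hp)
  have hvol : ∫ x in unitCube 3, LinearMap.trace ℝ E3 (fderiv ℝ X (q.toFun x)).toLinearMap *
        det3 (q.partialDeriv 0 x) (q.partialDeriv 1 x) (q.partialDeriv 2 x)
      = r * cubeVolume v q := by
    rw [cubeVolume, ← integral_const_mul]
    refine setIntegral_congr_fun (measurableSet_unitCube 3) fun x hx => ?_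
    simp only [hdiv _ (hQ q hq (Set.mem_image_of_mem _ hx)), mul_assoc]
  rw [hvol] at key
  have hsingle : ∀ σ : SmoothCube 2, chainFlux X (Finsupp.single σ 1) = flux X σ := fun σ => by
    simp [chainFlux_apply]
  simp only [map_sum, map_zsmul, map_sub, hsingle, zsmul_eq_mul, Int.cast_mul, Int.cast_pow,
    Int.cast_neg, Int.cast_one]
  rw [mul_left_comm, key, Finset.mul_sum]
  exact Finset.sum_congr rfl fun i _ => by ring

/-! ### Flux and area -/

/-- The vector field `e^φ ξ`. -/
noncomputable def weightedField (v : E3) (ξ : E3 → E3) (p : E3) : E3 :=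
  Real.exp (inner ℝ p v) • ξ p

theorem integrableOn_areaDensity (v : E3) (σ : SmoothCube 2) :
    IntegrableOn (fun x => Real.exp (inner ℝ (σ.toFun x) v) *
      Real.sqrt (‖σ.partialDeriv 0 x‖ ^ 2 * ‖σ.partialDeriv 1 x‖ ^ 2
        - inner ℝ (σ.partialDeriv 0 x) (σ.partialDeriv 1 x) ^ 2)) (unitCube 2) := by
  have h0 := σ.continuousOn_partialDeriv 0
  have h1 := σ.continuousOn_partialDeriv 1
  refine ContinuousOn.integrableOn_compact (isCompact_unitCube 2) ?_
  exact (Real.continuous_exp.comp_continuousOn (σ.continuousOn.inner continuousOn_const)).mul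
    (Real.continuous_sqrt.comp_continuousOn
      (((h0.norm.pow 2).mul (h1.norm.pow 2)).sub ((h0.inner h1).pow 2)))

/-- No measurability of ξ is required: only the dominating area density has to be integrable. -/
theorem abs_flux_le_cubeArea (v : E3) {ξ : E3 → E3} (hξ : ∀ p, ‖ξ p‖ = 1) (σ : SmoothCube 2) :
    |flux (weightedField v ξ) σ| ≤ cubeArea v σ := by
  rw [flux, cubeArea, ← Real.norm_eq_abs]
  refine norm_integral_le_of_norm_le (integrableOn_areaDensity v σ) (.of_forall fun x => ?_)
  rw [weightedField, det3_smul_right, Real.norm_eq_abs, abs_mul, Real.abs_exp]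
  exact mul_le_mul_of_nonneg_left (abs_det3_le _ _ _ (hξ _)) (Real.exp_nonneg _)

theorem chainFlux_le_weightedArea (v : E3) {ξ : E3 → E3} (hξ : ∀ p, ‖ξ p‖ = 1)
    (T : CubeChain 2) : chainFlux (weightedField v ξ) T ≤ weightedArea v T := by
  refine Finset.sum_le_sum fun σ _ => ?_
  calc (T σ : ℝ) * flux (weightedField v ξ) σ
      ≤ |(T σ : ℝ) * flux (weightedField v ξ) σ| := le_abs_self _
    _ = |(T σ : ℝ)| * |flux (weightedField v ξ) σ| := abs_mul _ _
    _ ≤ |(T σ : ℝ)| * cubeArea v σ :=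
      mul_le_mul_of_nonneg_left (abs_flux_le_cubeArea v hξ σ) (abs_nonneg _)

theorem weightedArea_eq_chainFlux (v : E3) {ξ : E3 → E3} (hξ : ∀ p, ‖ξ p‖ = 1) (S : CubeChain 2)
    (hsign : ∀ σ ∈ S.support, S σ = 1 ∨ S σ = -1)
    (horth : ∀ σ ∈ S.support, ∀ x ∈ unitCube 2, ∀ i,
      inner ℝ (σ.partialDeriv i x) (ξ (σ.toFun x)) = 0)
    (hpos : ∀ σ ∈ S.support, ∀ x ∈ unitCube 2,
      0 < (S σ : ℝ) * det3 (σ.partialDeriv 0 x) (σ.partialDeriv 1 x) (ξ (σ.toFun x))) :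
    weightedArea v S = chainFlux (weightedField v ξ) S := by
  refine Finset.sum_congr rfl fun σ hσ => ?_
  have habs : |(S σ : ℝ)| = 1 := by
    rcases hsign σ hσ with h | h <;> simp [h]
  change |(S σ : ℝ)| * cubeArea v σ = (S σ : ℝ) * flux (weightedField v ξ) σ
  rw [habs, one_mul, flux, cubeArea, ← integral_const_mul]
  refine setIntegral_congr_fun (measurableSet_unitCube 2) fun x hx => ?_
  have h := abs_det3_eq _ _ _ (hξ (σ.toFun x)) (horth σ hσ x hx 0) (horth σ hσ x hx 1)
  -- Orthogonality makes |det| the area element; positive orientation removes the absolute value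
  -- once the sign `S σ` is included.
  have h' := abs_of_pos (hpos σ hσ x hx)
  rw [abs_mul, habs, one_mul] at h'
  simp only [weightedField, det3_smul_right]
  rw [← h, h']
  ring

theorem flux_eq_zero_of_interior (X : E3 → E3) (σ : SmoothCube 2)
    (h : ∀ x ∈ interior (unitCube 2), ∀ c, det3 (σ.partialDeriv 0 x) (σ.partialDeriv 1 x) c = 0) :
    flux X σ = 0 := by
  refine setIntegral_eq_zero_of_forall_eq_zero fun x hx => ?_
  -- X may be discontinuous, so its value at `x` is frozen and only the partial derivatives pass to
  -- the limit at the boundary.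
  exact eq_zero_of_eq_zero_on_interior (continuousOn_det3 (σ.continuousOn_partialDeriv 0)
    (σ.continuousOn_partialDeriv 1) (continuousOn_const (c := X (σ.toFun x))))
    (fun y hy => h y hy _) x hx

theorem SmoothCube.IsDegenerate.exists_partialDeriv_eq_zero {n : ℕ} {σ : SmoothCube n}
    (hσ : σ.IsDegenerate) :
    ∃ i, ∀ x ∈ interior (unitCube n), σ.partialDeriv i x = 0 := by
  obtain ⟨i, hi⟩ := hσ
  refine ⟨i, fun x hx => ?_⟩
  have hD := ((σ.contDiffAt hx).differentiableAt (by simp)).hasFDerivAt.hasLineDerivAt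
    (Pi.single i (1 : ℝ))
  have hline : Filter.Tendsto (fun t : ℝ => x + t • (Pi.single i (1 : ℝ) : Fin n → ℝ)) (nhds 0)
      (nhds x) := by
    have : Continuous fun t : ℝ => x + t • (Pi.single i (1 : ℝ) : Fin n → ℝ) := by fun_prop
    simpa using this.tendsto 0
  have hconst : (fun t : ℝ => σ.toFun (x + t • (Pi.single i (1 : ℝ) : Fin n → ℝ)))
      =ᶠ[nhds 0] fun _ => σ.toFun x := by
    filter_upwards [hline (mem_interior_iff_mem_nhds.1 hx)] with t ht
    refine hi _ ht _ (interior_subset hx) fun j hj => ?_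
    simp [Pi.single_eq_of_ne hj]
  rw [σ.partialDeriv_of_mem_interior i hx]
  exact HasDerivAt.unique hD ((hasDerivAt_const (0 : ℝ) (σ.toFun x)).congr_of_eventuallyEq hconst)

theorem flux_eq_zero_of_isDegenerate (X : E3 → E3) {σ : SmoothCube 2} (hσ : σ.IsDegenerate) :
    flux X σ = 0 := by
  obtain ⟨i, hi⟩ := hσ.exists_partialDeriv_eq_zero
  refine flux_eq_zero_of_interior X σ fun x hx c => ?_
  fin_cases i
  · exact det3_eq_zero_of_smul_add_smul_eq_zero (r := 1) (s := 0) (by simpa using hi x hx)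
      (by simp) c
  · exact det3_eq_zero_of_smul_add_smul_eq_zero (r := 0) (s := 1) (by simpa using hi x hx)
      (by simp) c

theorem contDiffAt_gradient {E : Type*} [NormedAddCommGroup E] [InnerProductSpace ℝ E]
    [CompleteSpace E] {u : E → ℝ} {x : E} (hu : ContDiffAt ℝ ∞ u x) :
    ContDiffAt ℝ 1 (gradient u) x := by
  have h1 := hu.fderiv_right (m := 1) (one_add_one_eq_two.trans_le two_le_infty)
  -- Over ℝ the conjugate-linear Riesz isometry is linear by definition.
  let L : StrongDual ℝ E →L[ℝ] E :=
    ((InnerProductSpace.toDual ℝ E).symm.toContinuousLinearEquiv : StrongDual ℝ E →L⋆[ℝ] E)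
  exact L.contDiff.contDiffAt.comp x h1

/-! ### The geometry of graphs over `v^⊥` -/

section Graph

variable {v : E3} {u : plane v → ℝ}

/-- The orthogonal projection to the plane `v^⊥`. -/
noncomputable abbrev proj (v : E3) : E3 →L[ℝ] plane v := (plane v).orthogonalProjectionOnto

theorem inner_coe_plane (a : plane v) : inner ℝ (a : E3) v = 0 :=
  Submodule.mem_orthogonal_singleton_iff_inner_left.1 a.2

theorem proj_self (v : E3) : proj v v = 0 :=
  Submodule.orthogonalProjectionOnto_orthogonalComplement_singleton_eq_zero v

theorem proj_coe_add_smul (a : plane v) (t : ℝ) : proj v ((a : E3) + t • v) = a := by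
  rw [map_add, map_smul, proj_self, smul_zero, add_zero,
    Submodule.orthogonalProjectionOnto_mem_subspace_eq_self]

theorem proj_graphMap (x : plane v) : proj v (graphMap v u x) = x := proj_coe_add_smul x _

theorem graphMap_proj_of_mem {D : Set (plane v)} {p : E3} (hp : p ∈ graphMap v u '' D) :
    proj v p ∈ D ∧ graphMap v u (proj v p) = p := by
  obtain ⟨x, hx, rfl⟩ := hp
  rw [proj_graphMap]
  exact ⟨hx, rfl⟩

theorem exists_eq_coe_add_smul (hv : ‖v‖ = 1) (p : E3) :
    ∃ (a : plane v) (t : ℝ), p = (a : E3) + t • v := by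
  refine ⟨⟨p - (inner ℝ p v : ℝ) • v, ?_⟩, inner ℝ p v, by simp⟩
  rw [Submodule.mem_orthogonal_singleton_iff_inner_left, inner_sub_left, inner_smul_left,
    real_inner_self_eq_norm_sq, hv]
  simp

theorem finrank_plane (hv : ‖v‖ = 1) : Module.finrank ℝ (plane v) = 2 := by
  have : Fact (Module.finrank ℝ E3 = 2 + 1) := ⟨by simp⟩
  exact Submodule.finrank_orthogonal_span_singleton (by rintro rfl; simp at hv)

theorem hasFDerivAt_graphMap {x : plane v} (hu : DifferentiableAt ℝ u x) :
    HasFDerivAt (graphMap v u) ((plane v).subtypeL + (fderiv ℝ u x).smulRight v) x :=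
  (plane v).subtypeL.hasFDerivAt.add (hu.hasFDerivAt.smul_const v)

theorem fderiv_graphMap_apply {x : plane v} (hu : DifferentiableAt ℝ u x) (a : plane v) :
    fderiv ℝ (graphMap v u) x a = (a : E3) + fderiv ℝ u x a • v := by
  rw [(hasFDerivAt_graphMap hu).fderiv]
  simp

/-- The partial derivatives of a cube in a graph are tangent to the graph. -/
theorem partialDeriv_eq_of_image_subset_graph {n : ℕ} {D : Set (plane v)}
    (hu : ∀ x ∈ D, DifferentiableAt ℝ u x) (σ : SmoothCube n)
    (hσ : σ.image ⊆ graphMap v u '' D) {x : Fin n → ℝ} (hx : x ∈ unitCube n) (i : Fin n) :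
    σ.partialDeriv i x
      = fderiv ℝ (graphMap v u) (proj v (σ.toFun x)) (proj v (σ.partialDeriv i x)) := by
  have hmem : ∀ y ∈ unitCube n, proj v (σ.toFun y) ∈ D ∧
      graphMap v u (proj v (σ.toFun y)) = σ.toFun y := fun y hy =>
    graphMap_proj_of_mem (hσ (Set.mem_image_of_mem _ hy))
  have hF := (hasFDerivAt_graphMap (hu _ (hmem x hx).1)).differentiableAt.hasFDerivAt
  have h1 := (σ.differentiableWithinAt hx).hasFDerivWithinAt
  have h2 := (hF.comp_hasFDerivWithinAt x ((proj v).hasFDerivAt.comp_hasFDerivWithinAt x h1))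
  -- On the cube, σ equals the graph map composed with the projection of σ; differentiating this
  -- identity gives the claim.
  have h3 := h2.congr (f₁ := σ.toFun) (fun y hy => (hmem y hy).2.symm) (hmem x hx).2.symm
  conv_lhs => rw [SmoothCube.partialDeriv, h3.fderivWithin (uniqueDiffOn_unitCube n x hx)]
  rfl

/-- A `2`-cube in the part of a graph over a set with empty interior is nowhere immersed. -/
theorem det3_partialDeriv_eq_zero (hv : ‖v‖ = 1) {D : Set (plane v)} (hD : interior D = ∅)
    (hu : ∀ x ∈ D, DifferentiableAt ℝ u x) (σ : SmoothCube 2)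
    (hσ : σ.image ⊆ graphMap v u '' D) {x : Fin 2 → ℝ} (hx : x ∈ interior (unitCube 2))
    (c : E3) : det3 (σ.partialDeriv 0 x) (σ.partialDeriv 1 x) c = 0 := by
  have hstrict := (proj v).hasStrictFDerivAt.comp x
    ((σ.contDiffAt hx).hasStrictFDerivAt (by simp))
  set L := proj v ∘L fderiv ℝ σ.toFun x with hL
  have hnsurj : ¬ Function.Surjective L := by
    intro hsurj
    -- A submersion is open, so the projected cube would contain a neighbourhood, against the empty
    -- interior of `D`.
    have hmap := hstrict.map_nhds_eq_of_surj (LinearMap.range_eq_top.2 hsurj)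
    have hDn : D ∈ nhds (proj v (σ.toFun x)) := by
      rw [← hmap]
      refine Filter.mem_of_superset
        (Filter.image_mem_map (mem_interior_iff_mem_nhds.1 hx)) ?_
      rintro _ ⟨y, hy, rfl⟩
      exact (graphMap_proj_of_mem (hσ (Set.mem_image_of_mem _ hy))).1
    simpa [hD] using mem_interior_iff_mem_nhds.2 hDn
  have hninj : ¬ Function.Injective L := fun hinj => hnsurj
    ((LinearMap.injective_iff_surjective_of_finrank_eq_finrank (f := L.toLinearMap)
      (by rw [finrank_plane hv]; simp)).1 hinj)
  obtain ⟨w, hw, hw0⟩ : ∃ w, L w = 0 ∧ w ≠ 0 := by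
    by_contra! h
    exact hninj ((injective_iff_map_eq_zero L).2 h)
  have hcomb : proj v (w 0 • σ.partialDeriv 0 x + w 1 • σ.partialDeriv 1 x) = 0 := by
    rw [← hw, hL, ContinuousLinearMap.comp_apply, σ.partialDeriv_of_mem_interior 0 hx,
      σ.partialDeriv_of_mem_interior 1 hx, ← map_smul, ← map_smul, ← map_add]
    congr 2
    ext j
    fin_cases j <;> simp
  refine det3_eq_zero_of_smul_add_smul_eq_zero (r := w 0) (s := w 1) ?_ ?_ c
  -- A vector tangent to the graph is determined by its projection, so the combination given by the
  -- kernel vector `w` vanishes in space as well.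
  · have htan := partialDeriv_eq_of_image_subset_graph hu σ hσ (interior_subset hx)
    rw [htan 0, htan 1, ← map_smul, ← map_smul, ← map_smul, ← map_smul, ← map_add, ← map_add,
      hcomb, map_zero]
  · by_contra! h
    exact hw0 (by ext j; fin_cases j <;> simp [h])

/-! ### The unit normal field of a graph -/

/-- The normal vector `v - ∇u` of the graph of `u`. -/
noncomputable def graphNormal (v : E3) (u : plane v → ℝ) (x : plane v) : E3 :=
  v - ((gradient u x : plane v) : E3)

/-- The unit normal `ν = (v - ∇u) / |v - ∇u|` of the graph of `u`. -/
noncomputable def graphUnitNormal (v : E3) (u : plane v → ℝ) (x : plane v) : E3 :=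
  ‖graphNormal v u x‖⁻¹ • graphNormal v u x

/-- The gradient lies in `plane v`, whatever its value. Hence the normal never vanishes, and the
unit normal has norm one even where `u` is not differentiable. -/
theorem inner_graphNormal (hv : ‖v‖ = 1) (x : plane v) : inner ℝ (graphNormal v u x) v = 1 := by
  rw [graphNormal, inner_sub_left, inner_coe_plane, real_inner_self_eq_norm_sq, hv]
  simp

theorem graphNormal_ne_zero (hv : ‖v‖ = 1) (x : plane v) : graphNormal v u x ≠ 0 := fun h => by
  simpa [h] using inner_graphNormal (u := u) hv x

theorem norm_graphUnitNormal (hv : ‖v‖ = 1) (x : plane v) : ‖graphUnitNormal v u x‖ = 1 := by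
  rw [graphUnitNormal, norm_smul, norm_inv, norm_norm,
    inv_mul_cancel₀ (norm_ne_zero_iff.2 (graphNormal_ne_zero hv x))]

theorem contDiffAt_graphNormal {x : plane v} (hu : ContDiffAt ℝ ∞ u x) :
    ContDiffAt ℝ 1 (graphNormal v u) x := by
  have hgrad := contDiffAt_gradient hu
  have hcoe : ContDiffAt ℝ 1 (fun y => ((gradient u y : plane v) : E3)) x :=
    (plane v).subtypeL.contDiff.contDiffAt.comp x hgrad
  exact contDiffAt_const.sub hcoe

theorem contDiffAt_graphUnitNormal (hv : ‖v‖ = 1) {x : plane v} (hu : ContDiffAt ℝ ∞ u x) :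
    ContDiffAt ℝ 1 (graphUnitNormal v u) x :=
  (((contDiffAt_graphNormal hu).norm ℝ (graphNormal_ne_zero hv x)).inv
    (norm_ne_zero_iff.2 (graphNormal_ne_zero hv x))).smul (contDiffAt_graphNormal hu)

/-- The tangent plane has codimension one, so its normals form a line; pairing with `v` gives the
coefficient. -/
theorem eq_smul_graphNormal (hv : ‖v‖ = 1) {x : plane v} (hu : DifferentiableAt ℝ u x) {n : E3}
    (hn : ∀ a, inner ℝ (fderiv ℝ (graphMap v u) x a) n = 0) :
    n = (inner ℝ n v : ℝ) • graphNormal v u x := by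
  rw [← sub_eq_zero]
  refine ext_inner_left ℝ fun p => ?_
  obtain ⟨a, t, rfl⟩ := exists_eq_coe_add_smul hv p
  have ha := hn a
  rw [fderiv_graphMap_apply hu, inner_add_left, real_inner_smul_left] at ha
  have hgrad : inner ℝ (a : E3) ((gradient u x : plane v) : E3) = fderiv ℝ u x a := by
    rw [← toDual_gradient, InnerProductSpace.toDual_apply_apply, real_inner_comm]
    rfl
  have hav : inner ℝ (a : E3) (graphNormal v u x) = - fderiv ℝ u x a := by
    rw [graphNormal, inner_sub_right, inner_coe_plane, hgrad, zero_sub]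
  have hvv : inner ℝ v (graphNormal v u x) = (1 : ℝ) := by
    rw [real_inner_comm, inner_graphNormal hv]
  rw [inner_zero_right, inner_sub_right, real_inner_smul_right, inner_add_left, inner_add_left,
    real_inner_smul_left, real_inner_smul_left, hav, hvv, real_inner_comm v n]
  linear_combination ha

/-- A Gauss map of a connected graph is one of the two unit normal fields. -/
theorem IsGaussMap.exists_eq_smul_graphUnitNormal (hv : ‖v‖ = 1) {D : Set (plane v)}
    (hD : IsPreconnected D) (hu : ∀ x ∈ D, ContDiffAt ℝ ∞ u x) {N : E3 → E3}
    (hN : IsGaussMap (graphMap v u) D N) :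
    ∃ s : ℝ, (s = 1 ∨ s = -1) ∧ ∀ x ∈ D, N (graphMap v u x) = s • graphUnitNormal v u x := by
  have hdiff : ∀ x ∈ D, DifferentiableAt ℝ u x := fun x hx => (hu x hx).differentiableAt (by simp)
  -- The coefficient of `N` along ν: it is continuous with square one, hence constant on a
  -- preconnected set.
  let f : plane v → ℝ := fun x => inner ℝ (N (graphMap v u x)) v * ‖graphNormal v u x‖
  have hNf : ∀ x ∈ D, N (graphMap v u x) = f x • graphUnitNormal v u x := by
    intro x hx
    rw [graphUnitNormal, smul_smul, mul_assoc,
      mul_inv_cancel₀ (norm_ne_zero_iff.2 (graphNormal_ne_zero hv x)), mul_one]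
    exact eq_smul_graphNormal hv (hdiff x hx) (hN.orthogonal x hx)
  have hf : ContinuousOn f D := by
    have hF : ContinuousOn (graphMap v u) D := fun x hx =>
      (hasFDerivAt_graphMap (hdiff x hx)).continuousAt.continuousWithinAt
    have hn : ContinuousOn (graphNormal v u) D := fun x hx =>
      (contDiffAt_graphNormal (hu x hx)).continuousAt.continuousWithinAt
    exact ((hN.continuousOn.comp hF (Set.mapsTo_image _ _)).inner continuousOn_const).mul hn.norm
  have hsq : Set.EqOn (f ^ 2) 1 D := by
    intro x hx
    have h := hN.norm_eq_one x hx
    rw [hNf x hx, norm_smul, norm_graphUnitNormal hv, mul_one, Real.norm_eq_abs] at h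
    rw [Pi.pow_apply, ← sq_abs, h, one_pow, Pi.one_apply]
  rcases hD.eq_one_or_eq_neg_one_of_sq_eq hf hsq with h | h
  · exact ⟨1, Or.inl rfl, fun x hx => by rw [hNf x hx, h hx, Pi.one_apply]⟩
  · exact ⟨-1, Or.inr rfl, fun x hx => by rw [hNf x hx, h hx, Pi.neg_apply, Pi.one_apply]⟩

/-! ### The calibrating field -/

/-- The unit field on the cylinder that is constant along `v` and normal to the graph. -/
noncomputable def verticalExtension (v : E3) (u : plane v → ℝ) (s : ℝ) (p : E3) : E3 :=
  s • graphUnitNormal v u (proj v p)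

theorem contDiffAt_weightedField (hv : ‖v‖ = 1) (s : ℝ) {p : E3}
    (hu : ContDiffAt ℝ ∞ u (proj v p)) :
    ContDiffAt ℝ 1 (weightedField v (verticalExtension v u s)) p := by
  have h1 : ContDiffAt ℝ 1 (fun p : E3 => Real.exp (inner ℝ p v)) p :=
    (contDiffAt_id.inner ℝ contDiffAt_const).exp
  have h2 : ContDiffAt ℝ 1 (fun p : E3 => graphUnitNormal v u (proj v p)) p :=
    (contDiffAt_graphUnitNormal hv hu).comp p (proj v).contDiff.contDiffAt
  exact h1.smul (h2.const_smul s)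

/-- The divergence of `e^φ ξ` is `e^φ (⟨ξ, v⟩ + div ξ)`. -/
theorem trace_fderiv_weightedField (hv : ‖v‖ = 1) (s : ℝ) {p : E3}
    (hu : ContDiffAt ℝ ∞ u (proj v p)) :
    LinearMap.trace ℝ E3 (fderiv ℝ (weightedField v (verticalExtension v u s)) p).toLinearMap
      = Real.exp (inner ℝ p v) * (inner ℝ (s • graphUnitNormal v u (proj v p)) v
        + s * LinearMap.trace ℝ (plane v)
          ((proj v).toLinearMap ∘ₗ (fderiv ℝ (graphUnitNormal v u) (proj v p)).toLinearMap)) := by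
  have hν := ((contDiffAt_graphUnitNormal hv hu).differentiableAt one_ne_zero).hasFDerivAt
  have hinner : HasFDerivAt (fun p : E3 => inner ℝ p v) (innerSL ℝ v) p := by
    refine (innerSL ℝ v).hasFDerivAt.congr_of_eventuallyEq (.of_forall fun q => ?_)
    simp [real_inner_comm]
  have hX : HasFDerivAt (weightedField v (verticalExtension v u s))
      (Real.exp (inner ℝ p v) • (s • (fderiv ℝ (graphUnitNormal v u) (proj v p) ∘L proj v))
        + (Real.exp (inner ℝ p v) • innerSL ℝ v).smulRight
          (s • graphUnitNormal v u (proj v p))) p :=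
    hinner.exp.smul ((hν.comp p (proj v).hasFDerivAt).const_smul s)
  have hlin : (fderiv ℝ (weightedField v (verticalExtension v u s)) p).toLinearMap
      = Real.exp (inner ℝ p v) • ((innerSL ℝ v).toLinearMap.smulRight
          (s • graphUnitNormal v u (proj v p))
        + s • ((fderiv ℝ (graphUnitNormal v u) (proj v p)).toLinearMap
          ∘ₗ (proj v).toLinearMap)) := by
    rw [hX.fderiv]
    refine LinearMap.ext fun w => ?_
    change Real.exp (inner ℝ p v) • (s • fderiv ℝ (graphUnitNormal v u) (proj v p) (proj v w))
        + (Real.exp (inner ℝ p v) * innerSL ℝ v w) • (s • graphUnitNormal v u (proj v p))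
      = Real.exp (inner ℝ p v) • (innerSL ℝ v w • (s • graphUnitNormal v u (proj v p))
        + s • fderiv ℝ (graphUnitNormal v u) (proj v p) (proj v w))
    rw [smul_add, mul_smul, add_comm]
  -- Cyclicity of the trace replaces dν ∘ proj on space by proj ∘ dν on the plane; the rank-one part
  -- contributes ⟨ξ, v⟩.
  rw [hlin, map_smul, map_add, map_smul, LinearMap.trace_smulRight, LinearMap.trace_comp_comm',
    ContinuousLinearMap.coe_coe, innerSL_apply_apply, smul_eq_mul, smul_eq_mul, real_inner_comm v (s • _)]

/-- The soliton equation in terms of the unit normal, at the points of the open domain. -/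
theorem inner_add_trace_eq_of_soliton {lam s : ℝ} {U : Set (plane v)}
    (hU : IsOpen U) (hu : ∀ x ∈ U, ContDiffAt ℝ ∞ u x) {N : E3 → E3}
    (hs : ∀ x ∈ U, N (graphMap v u x) = s • graphUnitNormal v u x) (hv : ‖v‖ = 1)
    (hsol : SolitonEquation v lam (graphMap v u) U N) {x : plane v} (hx : x ∈ U) :
    inner ℝ (s • graphUnitNormal v u x) v + s * LinearMap.trace ℝ (plane v)
      ((proj v).toLinearMap ∘ₗ (fderiv ℝ (graphUnitNormal v u) x).toLinearMap) = -lam := by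
  obtain ⟨-, -, A, hA, htr⟩ := hsol x hx
  have hν := ((contDiffAt_graphUnitNormal hv (hu x hx)).differentiableAt one_ne_zero).hasFDerivAt
  have hNF : fderiv ℝ (N ∘ graphMap v u) x = s • fderiv ℝ (graphUnitNormal v u) x := by
    refine ((hν.const_smul s).congr_of_eventuallyEq ?_).fderiv
    filter_upwards [hU.mem_nhds hx] with y hy
    exact hs y hy
  have hlin : s • ((proj v).toLinearMap ∘ₗ (fderiv ℝ (graphUnitNormal v u) x).toLinearMap)
      = -A := by
    ext a : 1
    -- Projection is a left inverse of the derivative of the graph map, so projecting dN = -dF ∘ A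
    -- isolates the shape operator `A`.
    have ha := congrArg (proj v) (hA a)
    rw [hNF, fderiv_graphMap_apply ((hu x hx).differentiableAt (by simp)), map_neg,
      proj_coe_add_smul] at ha
    simpa using ha
  have htrace := congrArg (LinearMap.trace ℝ (plane v)) hlin
  rw [map_smul, map_neg, htr, hs x hx, smul_eq_mul] at htrace
  rw [htrace]
  ring

/-- The soliton equation extends to the closure by continuity. -/
theorem inner_add_trace_eq_of_soliton_closure {lam s : ℝ} {U : Set (plane v)}
    (hU : IsOpen U) (hu : ∀ x ∈ closure U, ContDiffAt ℝ ∞ u x) {N : E3 → E3}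
    (hs : ∀ x ∈ U, N (graphMap v u x) = s • graphUnitNormal v u x) (hv : ‖v‖ = 1)
    (hsol : SolitonEquation v lam (graphMap v u) U N) {x : plane v} (hx : x ∈ closure U) :
    inner ℝ (s • graphUnitNormal v u x) v + s * LinearMap.trace ℝ (plane v)
      ((proj v).toLinearMap ∘ₗ (fderiv ℝ (graphUnitNormal v u) x).toLinearMap) = -lam := by
  refine Set.EqOn.of_subset_closure (g := fun _ => -lam) (s := U) (t := closure U)
    (fun y hy => inner_add_trace_eq_of_soliton hU (fun z hz => hu z (subset_closure hz)) hs hv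
      hsol hy) (fun y hy => ContinuousAt.continuousWithinAt ?_) continuousOn_const
    subset_closure subset_rfl hx
  have hν := contDiffAt_graphUnitNormal hv (hu y hy)
  have hDν : ContinuousAt (fderiv ℝ (graphUnitNormal v u)) y :=
    (hν.fderiv_right (m := 0) (by simp)).continuousAt
  have htr : Continuous fun L : plane v →L[ℝ] E3 =>
      LinearMap.trace ℝ (plane v) ((proj v).toLinearMap ∘ₗ L.toLinearMap) :=
    LinearMap.continuous_of_finiteDimensional
      ((LinearMap.trace ℝ (plane v)) ∘ₗ (LinearMap.llcomp ℝ _ _ _ (proj v).toLinearMap) ∘ₗ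
        (ContinuousLinearMap.coeLM ℝ))
  exact ((hν.continuousAt.const_smul s).inner continuousAt_const).add
    (continuousAt_const.mul (htr.continuousAt.comp hDν))

theorem image_subset_cylinder (D : Set (plane v)) : graphMap v u '' D ⊆ cylinder v D := by
  rintro _ ⟨x, hx, rfl⟩
  exact ⟨x, hx, u x, rfl⟩

theorem proj_mem_of_mem_cylinder {D : Set (plane v)} {p : E3} (hp : p ∈ cylinder v D) :
    proj v p ∈ D := by
  obtain ⟨x, hx, t, rfl⟩ := hp
  rwa [proj_coe_add_smul]

end Graph

/-! ### Relative chains and the comparison of areas -/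

theorem chainFlux_eq_zero_of_isZeroRel {v : E3} (hv : ‖v‖ = 1) {u : plane v → ℝ}
    {D : Set (plane v)} (hD : interior D = ∅) (hu : ∀ x ∈ D, DifferentiableAt ℝ u x)
    (X : E3 → E3) {c : CubeChain 2} (hc : IsZeroRel (graphMap v u '' D) c) :
    chainFlux X c = 0 := by
  refine Finset.sum_eq_zero fun σ hσ => ?_
  change (c σ : ℝ) * flux X σ = 0
  rcases hc σ hσ with h | h
  · rw [flux_eq_zero_of_isDegenerate X h, mul_zero]
  · rw [flux_eq_zero_of_interior X σ fun x hx => det3_partialDeriv_eq_zero hv hD hu σ h hx,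
      mul_zero]

theorem IsCellulation.image_subset {M B : Set E3} {N : E3 → E3} {S : CubeChain 2}
    (hS : IsCellulation M B N S) {σ : SmoothCube 2} (hσ : σ ∈ S.support) : σ.image ⊆ M := by
  rw [← hS.cover]
  exact Set.subset_biUnion_of_mem (u := fun σ : SmoothCube 2 => σ.image) hσ

theorem self_mem_comparisonClass {v : E3} {Y B : Set E3} {S : CubeChain 2}
    (hS : IsChainIn Y S) : S ∈ comparisonClass v Y B S := by
  refine ⟨hS, 0, ⟨?_, ?_⟩, ?_⟩
  · intro q hq
    simp at hq
  · intro σ hσ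
    simp [boundary] at hσ
  · simp [weightedVolume]

end TranslatingSoliton

open TranslatingSoliton
theorem theorem3p3 (v : E3) (hv : ‖v‖ = 1) (lam : ℝ)
    -- the domain `U` of the plane `v^⊥`, and the compact graph of `u` over its closure
    (U : Set (plane v)) (hU_open : IsOpen U) (hU_conn : IsConnected U)
    (u : plane v → ℝ) (hu : ∀ x ∈ closure U, ContDiffAt ℝ ∞ u x)
    (hcompact : IsCompact (graphMap v u '' closure U))
    -- it is a translating soliton with respect to the Gauss map `N`
    (N : E3 → E3) (hN : IsGaussMap (graphMap v u) (closure U) N)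
    (hsoliton : SolitonEquation v lam (graphMap v u) U N)
    -- its fundamental chain
    (S : CubeChain 2)
    (hS : IsCellulation (graphMap v u '' closure U) (graphMap v u '' frontier U) N S) :
    S ∈ comparisonClass v (cylinder v (closure U)) (graphMap v u '' frontier U) S ∧
      ∀ T ∈ comparisonClass v (cylinder v (closure U)) (graphMap v u '' frontier U) S,
        weightedArea v S ≤ weightedArea v T := by
  refine ⟨self_mem_comparisonClass fun σ hσ =>
    (hS.image_subset hσ).trans (image_subset_cylinder _), ?_⟩
  rintro T ⟨-, Q, ⟨hQ, hzero⟩, hvol⟩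
  have hdiff : ∀ x ∈ closure U, DifferentiableAt ℝ u x := fun x hx =>
    (hu x hx).differentiableAt (by simp)
  obtain ⟨s, hs, hNs⟩ := hN.exists_eq_smul_graphUnitNormal hv hU_conn.isPreconnected.closure hu
  have hunit : ∀ p, ‖verticalExtension v u s p‖ = 1 := fun p => by
    rw [verticalExtension, norm_smul, norm_graphUnitNormal hv]
    rcases hs with rfl | rfl <;> simp
  have hNext : ∀ p ∈ graphMap v u '' closure U, N p = verticalExtension v u s p := fun p hp => by
    have h := graphMap_proj_of_mem hp
    rw [verticalExtension, ← hNs _ h.1, h.2]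
  -- Only frontiers of open or closed sets are sure to have empty interior; here the closed
  -- complement is used.
  have hfrontier : interior (frontier U) = ∅ := by
    rw [← frontier_compl]
    exact interior_frontier hU_open.isClosed_compl
  have hstokes := chainFlux_boundary v (weightedField v (verticalExtension v u s)) (-lam)
    (cylinder v (closure U))
    (fun p hp => contDiffAt_weightedField hv s (hu _ (proj_mem_of_mem_cylinder hp)))
    (fun p hp => by
      rw [trace_fderiv_weightedField hv s (hu _ (proj_mem_of_mem_cylinder hp)),
        inner_add_trace_eq_of_soliton_closure hU_open hu
          (fun x hx => hNs x (subset_closure hx)) hv hsoliton (proj_mem_of_mem_cylinder hp),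
        mul_comm]) Q hQ
  have hrel := chainFlux_eq_zero_of_isZeroRel hv hfrontier
    (fun x hx => hdiff x (frontier_subset_closure hx))
    (weightedField v (verticalExtension v u s)) hzero
  -- Zero weighted volume removes the Stokes term for every λ, so `T` and `S` have equal flux.
  rw [map_sub, map_sub, hstokes, hvol, mul_zero, sub_zero, sub_eq_zero] at hrel
  have hmem : ∀ σ ∈ S.support, ∀ x ∈ unitCube 2, σ.toFun x ∈ graphMap v u '' closure U :=
    fun σ hσ x hx => hS.image_subset hσ (Set.mem_image_of_mem _ hx)
  have hSarea : weightedArea v S = chainFlux (weightedField v (verticalExtension v u s)) S := by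
    refine weightedArea_eq_chainFlux v hunit S hS.sign (fun σ hσ x hx i => ?_)
      fun σ hσ x hx => ?_
    · have h := graphMap_proj_of_mem (hmem σ hσ x hx)
      have horth := hN.orthogonal _ h.1 (proj v (σ.partialDeriv i x))
      rwa [← partialDeriv_eq_of_image_subset_graph hdiff σ (hS.image_subset hσ) hx i, h.2,
        hNext _ (hmem σ hσ x hx)] at horth
    · rw [← hNext _ (hmem σ hσ x hx)]
      exact hS.oriented σ hσ x hx
  rw [hSarea, ← hrel]
  exact chainFlux_le_weightedArea v hunit T
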